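/- Let $\alpha,\beta\in\mathbb{C}$ with $\alpha,\ \beta,\ \alpha+\beta+1\notin\{-1,-2,\ldots\}$. Let $\Sigma$ be the Pochhammer contour: the closed contour on the Riemann surface of $t^z(1-t)^w$ over $\mathbb{C}\setminus\{0,1\}$ that starts at $t=\tfrac12$ with $\arg t=\arg(1-t)=0$ and runs through the circle of radius $\tfrac12$ about $1$ in the positive sense, the circle of radius $\tfrac12$ about $0$ in the positive sense, the circle about $1$ in the negative sense, and the circle about $0$ in the negative sense. Define $\mu^{(\alpha,\beta)}$ by $$\int h(x)\,d\mu^{(\alpha,\beta)}(x)=\lim_{\substack{z\to\alpha,\ w\to\beta\\ z,w\in\mathbb{C}\setminus\mathbb{Z}}}(1-e^{2\pi i z})^{-1}(1-e^{2\pi i w})^{-1}\int_\Sigma h(t)\,t^z(1-t)^w\,dt .$$ Then: 1. The limit exists for every entire function $h$. For every polynomial $h$, the value $\int h\,d\mu^{(\alpha,\beta)}$ is meromorphic on $\mathbb{C}$ in each of the two parameters (the other one being fixed outside $\{-1,-2,\ldots\}$), and it equals $\int_0^1 h(x)\,x^\alpha(1-x)^\beta\,dx$ if $\Re\alpha>-1$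 and $\Re\beta>-1$. 2. The single measure $\mu^{(\alpha,\beta)}$ is a perfect system: for every $n\ge 0$, every polynomial $p\neq 0$ of degree at most $n$ with $\int p(x)x^k\,d\mu^{(\alpha,\beta)}(x)=0$ for $k=0,\ldots,n-1$ has exact degree $n$. 3. For every $n\ge0$, the $n$-th formal orthogonal polynomial (the polynomial $p\ne0$ of degree at most $n$ satisfying the orthogonality conditions in 2, unique up to a scalar factor) is the shifted Jacobi polynomial $$P_n^{(\alpha,\beta)}(x)=\frac{(\alpha+1)_n}{n!}\;{}_2F_1\!\left(-n,\ \alpha+\beta+n+1;\ \alpha+1;\ x\right),$$ where $(a)_n=a(a+1)\cdots(a+n-1)$. -/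

import Mathlib

open Filter Topology Polynomial

noncomputable section

namespace FormalJacobi

/-- The Riemann surface of `t ^ z * (1 - t) ^ w` over `ℂ \ {0, 1}`: a point is a pair `(u, v)`
consisting of a value `u` of `log t` and a value `v` of `log (1 - t)`. -/
def surface : Set (ℂ × ℂ) := {p | Complex.exp p.1 + Complex.exp p.2 = 1}

/-- The projection `(u, v) ↦ t = exp u` of the Riemann surface to the `t`-plane. -/
def proj (p : ℂ × ℂ) : ℂ := Complex.exp p.1

/-- The function `t ^ z * (1 - t) ^ w = exp (z * log t + w * log (1 - t))` on the Riemann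
surface. -/
def weight (z w : ℂ) (p : ℂ × ℂ) : ℂ := Complex.exp (z * p.1 + w * p.2)

/-- The closed contour `Σ` (Pochhammer's contour), lifted to the Riemann surface, as four
consecutive arcs, each parametrized by `[0, 2π]`. It starts at `t = 1/2` with
`arg t = arg (1 - t) = 0` and runs through the circle of radius `1/2` about `1` in the positive
sense, the circle of radius `1/2` about `0` in the positive sense, the circle about `1` in the
negative sense, and the circle about `0` in the negative sense. So
`(arg t, arg (1 - t))` is successively `(0, 0)`, `(0, 2π)`, `(2π, 2π)`, `(2π, 0)`, `(0, 0)` at the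
passages through `t = 1/2`. -/
def arc : Fin 4 → ℝ → ℂ × ℂ
  | 0, θ => (Complex.log (1 - Complex.exp (θ * Complex.I) / 2),
      Complex.log (1 / 2) + θ * Complex.I)
  | 1, θ => (Complex.log (1 / 2) + θ * Complex.I,
      Complex.log (1 - Complex.exp (θ * Complex.I) / 2) + 2 * Real.pi * Complex.I)
  | 2, θ => (Complex.log (1 - Complex.exp ((2 * Real.pi - θ) * Complex.I) / 2)
        + 2 * Real.pi * Complex.I,
      Complex.log (1 / 2) + (2 * Real.pi - θ) * Complex.I)
  | 3, θ => (Complex.log (1 / 2) + (2 * Real.pi - θ) * Complex.I,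
      Complex.log (1 - Complex.exp ((2 * Real.pi - θ) * Complex.I) / 2))

/-- The contour integral `∫_Σ h(t) t ^ z (1 - t) ^ w dt`. -/
def contourIntegral (h : ℂ → ℂ) (z w : ℂ) : ℂ :=
  ∑ k : Fin 4, ∫ θ in (0 : ℝ)..(2 * Real.pi),
    h (proj (arc k θ)) * weight z w (arc k θ) * deriv (fun s : ℝ => proj (arc k s)) θ

/-- The normalized integral
`(1 - exp (2πiz))⁻¹ (1 - exp (2πiw))⁻¹ ∫_Σ h(t) t ^ z (1 - t) ^ w dt`, for non-integral `z`, `w`. -/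
def normalizedIntegral (h : ℂ → ℂ) (z w : ℂ) : ℂ :=
  (1 - Complex.exp (2 * Real.pi * Complex.I * z))⁻¹ *
    (1 - Complex.exp (2 * Real.pi * Complex.I * w))⁻¹ * contourIntegral h z w

/-- The set `ℂ \ ℤ`. -/
def nonIntegers : Set ℂ := (Set.range ((↑) : ℤ → ℂ))ᶜ

/-- The filter `z → α`, `w → β` with `z, w ∈ ℂ \ ℤ`. -/
def paramFilter (α β : ℂ) : Filter (ℂ × ℂ) := 𝓝[nonIntegers] α ×ˢ 𝓝[nonIntegers] β

/-- `∫ h dμ^{(α,β)}`: the limit of the normalized contour integrals as `z → α`, `w → β`. -/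
def jacobiMeasure (α β : ℂ) (h : ℂ → ℂ) : ℂ :=
  limUnder (paramFilter α β) fun p => normalizedIntegral h p.1 p.2

/-- `p` is a (formal) multiple orthogonal polynomial of type II with respect to the multi-index
`n` and the (complex) measures `μ j`, given by their integration functionals `h ↦ ∫ h dμ_j`. -/
def IsMultipleOrthogonal {m : ℕ} (μ : Fin m → (ℂ → ℂ) → ℂ) (n : Fin m → ℕ) (p : ℂ[X]) : Prop :=
  p ≠ 0 ∧ p.natDegree ≤ ∑ j, n j ∧ ∀ j, ∀ k < n j, μ j (fun t => p.eval t * t ^ k) = 0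

/-- The multi-index `n` is normal: each multiple orthogonal polynomial has exact degree `|n|`. -/
def IsNormalIndex {m : ℕ} (μ : Fin m → (ℂ → ℂ) → ℂ) (n : Fin m → ℕ) : Prop :=
  ∀ p : ℂ[X], IsMultipleOrthogonal μ n p → p.natDegree = ∑ j, n j

/-- A system of measures is perfect if every multi-index is normal. -/
def IsPerfectSystem {m : ℕ} (μ : Fin m → (ℂ → ℂ) → ℂ) : Prop :=
  ∀ n : Fin m → ℕ, IsNormalIndex μ n

/-- The Pochhammer symbol `(a)_k = a (a + 1) ⋯ (a + k - 1)`. -/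
def poch (a : ℂ) (k : ℕ) : ℂ := (ascPochhammer ℂ k).eval a

/-- The shifted Jacobi polynomial
`P_n^{(α,β)}(x) = (α+1)_n / n! * ₂F₁(-n, α+β+n+1; α+1; x)`. -/
def jacobiPoly (α β : ℂ) (n : ℕ) : ℂ[X] :=
  C (poch (α + 1) n / (n.factorial : ℂ)) *
    ∑ k ∈ Finset.range (n + 1),
      C (poch (-(n : ℂ)) k * poch (α + β + n + 1) k / (poch (α + 1) k * (k.factorial : ℂ))) * X ^ k

/-! Checks of the definitions. -/

theorem jacobiPoly_eval (α β : ℂ) (n : ℕ) (x : ℂ) :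
    (jacobiPoly α β n).eval x = poch (α + 1) n / (n.factorial : ℂ) *
      ordinaryHypergeometric (-(n : ℂ)) (α + β + n + 1) (α + 1) x := by
  rw [ordinaryHypergeometric_eq_tsum, jacobiPoly]
  simp only [eval_mul, eval_C, eval_finsetSum, eval_pow, eval_X]
  congr 1
  rw [tsum_eq_sum (s := Finset.range (n + 1))]
  · refine Finset.sum_congr rfl fun k _ => ?_
    simp only [poch, smul_eq_mul]
    rw [div_eq_mul_inv, mul_inv]
    ring
  · intro k hk
    have hk' : n < k := by simpa [Nat.lt_succ_iff] using hk
    have : (ascPochhammer ℂ k).eval (-(n : ℂ)) = 0 :=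
      (ascPochhammer_eval_eq_zero_iff k (-(n : ℂ))).2 ⟨n, hk', by simp⟩
    simp [this]

theorem one_sub_mem_slitPlane (x : ℝ) :
    1 - Complex.exp (x * Complex.I) / 2 ∈ Complex.slitPlane := by
  left
  have h := Complex.exp_ofReal_mul_I_re x
  have h2 := Real.cos_le_one x
  have : (Complex.exp (x * Complex.I) / 2).re = Real.cos x / 2 := by
    rw [← h]; simp
  rw [Complex.sub_re, this, Complex.one_re]
  linarith

/-- The arcs lie on the Riemann surface. -/
theorem arc_mem_surface (k : Fin 4) (θ : ℝ) : arc k θ ∈ surface := by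
  have h1 := Complex.slitPlane_ne_zero (one_sub_mem_slitPlane θ)
  have h2 := Complex.slitPlane_ne_zero (one_sub_mem_slitPlane (2 * Real.pi - θ))
  push_cast at h2
  have h3 : (1 / 2 : ℂ) ≠ 0 := by norm_num
  fin_cases k <;>
    simp only [arc, surface, Set.mem_ofPred_eq, Complex.exp_add, Complex.exp_log h1,
      Complex.exp_log h2, Complex.exp_log h3, Complex.exp_two_pi_mul_I] <;> ring

/-- Each arc is differentiable. -/
theorem arc_differentiable (k : Fin 4) : Differentiable ℝ (arc k) := by
  intro θ
  have h1 := one_sub_mem_slitPlane θ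
  have h2 := one_sub_mem_slitPlane (2 * Real.pi - θ)
  push_cast at h2
  have e : DifferentiableAt ℝ (fun s : ℝ => (s : ℂ)) θ :=
    Complex.ofRealCLM.differentiableAt
  have i1 : DifferentiableAt ℝ
      (fun s : ℝ => 1 - Complex.exp (s * Complex.I) / 2) θ := by fun_prop
  have i2 : DifferentiableAt ℝ
      (fun s : ℝ => 1 - Complex.exp ((2 * Real.pi - s) * Complex.I) / 2) θ := by fun_prop
  have e1 : DifferentiableAt ℝ
      (fun s : ℝ => Complex.log (1 - Complex.exp (s * Complex.I) / 2)) θ :=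
    (i1.hasDerivAt.clog_real h1).differentiableAt
  have e2 : DifferentiableAt ℝ
      (fun s : ℝ => Complex.log (1 - Complex.exp ((2 * Real.pi - s) * Complex.I) / 2)) θ :=
    (i2.hasDerivAt.clog_real h2).differentiableAt
  fin_cases k
  · exact e1.prodMk (by fun_prop)
  · exact DifferentiableAt.prodMk (by fun_prop) (by fun_prop)
  · exact DifferentiableAt.prodMk (by fun_prop) (by fun_prop)
  · exact DifferentiableAt.prodMk (by fun_prop) e2

/-- The arcs join to a closed contour on the Riemann surface. -/
theorem arc_closed (k : Fin 4) : arc k (2 * Real.pi) = arc (k + 1) 0 := by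
  have h : (1 - 1 / 2 : ℂ) = 1 / 2 := by norm_num
  fin_cases k <;> simp [arc, Complex.exp_two_pi_mul_I] <;> norm_num

end FormalJacobi

end

/-! Pochhammer's contour splits into loops about 0 and about 1, which the substitution of 1 - t for
t exchanges. After normalization one summand is a loop about 0 divided by e^{2πiz} - 1, the other is
its mirror image with z and w exchanged (`normalizedIntegral_eq`). If Re z > -1, termwise
integration of a Taylor series collapses the loop to the segment [0, 1/2] and produces exactly the
factor e^{2πiz} - 1 (`zeroLoop_eq_mul_halfIntegral`). So the quotient extends across the integers z
≥ 0, and the excluded negative integers are the only other zeros of the denominator. This gives the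
limit and the classical integral.

The functional is then computed by algebra. Multiplication by t or 1 - t shifts a parameter by one,
and the derivative of t^{z+1}(1-t)^{w+1} integrates to 0 over the closed contour. The resulting
recurrences carry the Beta integral from Re α, Re β > -1 to all admissible parameters (`mass_eq`),
and meromorphy follows from that of Γ.

Testing P_n against (1-t)^k is a terminating sum that Chu–Vandermonde evaluates as a multiple of
(k+1-n)_n (`jacobiMeasure_jacobiPoly_mul_one_sub_pow`). This vanishes for k < n, which is
orthogonality. At k = n the whole value is nonzero, so a nonzero q of degree d always has ∫ P_d q ≠
0; this forces uniqueness, and perfectness follows because P_n has degree exactly n. -/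

namespace FormalJacobi

/-! ### Splitting the contour into loops about 0 and 1 -/

/-- The integrand of `∫ h(t) t ^ z (1 - t) ^ w dt` over the circle of radius `1 / 2` about `0`. -/
noncomputable def zeroLoopIntegrand (h : ℂ → ℂ) (z w : ℂ) (θ : ℝ) : ℂ :=
  h (Complex.exp (θ * Complex.I) / 2) *
    Complex.exp (z * (Complex.log (1 / 2) + θ * Complex.I)
      + w * Complex.log (1 - Complex.exp (θ * Complex.I) / 2)) *
    (Complex.exp (θ * Complex.I) / 2 * Complex.I)

/-- The integral `∫ h(t) t ^ z (1 - t) ^ w dt` over the circle of radius `1 / 2` about `0`, with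
`arg t` running from `0` to `2π`. -/
noncomputable def zeroLoop (h : ℂ → ℂ) (z w : ℂ) : ℂ :=
  ∫ θ in (0 : ℝ)..(2 * Real.pi), zeroLoopIntegrand h z w θ

/-- The integral `∫ h(t) t ^ z (1 - t) ^ w dt` over `[0, 1 / 2]`. -/
noncomputable def halfIntegral (h : ℂ → ℂ) (z w : ℂ) : ℂ :=
  ∫ x in (0 : ℝ)..(1 / 2), h x * ((x : ℂ) ^ z * (1 - (x : ℂ)) ^ w)

theorem exp_log_half : Complex.exp (Complex.log (1 / 2)) = 1 / 2 :=
  Complex.exp_log (by norm_num)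

theorem exp_log_one_sub (θ : ℝ) :
    Complex.exp (Complex.log (1 - Complex.exp (θ * Complex.I) / 2))
      = 1 - Complex.exp (θ * Complex.I) / 2 :=
  Complex.exp_log (Complex.slitPlane_ne_zero (one_sub_mem_slitPlane θ))

theorem exp_log_one_sub' (θ : ℝ) :
    Complex.exp (Complex.log (1 - Complex.exp ((2 * Real.pi - θ) * Complex.I) / 2))
      = 1 - Complex.exp ((2 * Real.pi - θ) * Complex.I) / 2 := by
  simpa using exp_log_one_sub (2 * Real.pi - θ)

theorem proj_arc_zero (θ : ℝ) : proj (arc 0 θ) = 1 - Complex.exp (θ * Complex.I) / 2 :=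
  exp_log_one_sub θ

theorem proj_arc_one (θ : ℝ) : proj (arc 1 θ) = Complex.exp (θ * Complex.I) / 2 := by
  simp only [arc, proj, Complex.exp_add, exp_log_half]; ring

theorem proj_arc_two (θ : ℝ) :
    proj (arc 2 θ) = 1 - Complex.exp ((2 * Real.pi - θ) * Complex.I) / 2 := by
  simp only [arc, proj, Complex.exp_add, exp_log_one_sub', Complex.exp_two_pi_mul_I, mul_one]

theorem proj_arc_three (θ : ℝ) :
    proj (arc 3 θ) = Complex.exp ((2 * Real.pi - θ) * Complex.I) / 2 := by
  simp only [arc, proj, Complex.exp_add, exp_log_half]; ring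

theorem hasDerivAt_exp_half (θ : ℝ) :
    HasDerivAt (fun s : ℝ => Complex.exp (s * Complex.I) / 2)
      (Complex.exp (θ * Complex.I) / 2 * Complex.I) θ := by
  have h := ((Complex.ofRealCLM.hasDerivAt (x := θ)).mul_const Complex.I).cexp.div_const 2
  refine (h.congr_deriv ?_)
  simp
  ring

theorem hasDerivAt_exp_half_sub (θ : ℝ) :
    HasDerivAt (fun s : ℝ => Complex.exp ((2 * Real.pi - s) * Complex.I) / 2)
      (-(Complex.exp ((2 * Real.pi - θ) * Complex.I) / 2 * Complex.I)) θ := by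
  have h := (hasDerivAt_exp_half (2 * Real.pi - θ)).scomp θ
    ((hasDerivAt_id θ).const_sub (2 * Real.pi))
  simpa [Function.comp_def] using h

theorem deriv_proj_arc_zero (θ : ℝ) :
    deriv (fun s : ℝ => proj (arc 0 s)) θ = -(Complex.exp (θ * Complex.I) / 2 * Complex.I) := by
  simp only [proj_arc_zero]
  exact ((hasDerivAt_exp_half θ).const_sub 1).deriv

theorem deriv_proj_arc_one (θ : ℝ) :
    deriv (fun s : ℝ => proj (arc 1 s)) θ = Complex.exp (θ * Complex.I) / 2 * Complex.I := by
  simp only [proj_arc_one]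
  exact (hasDerivAt_exp_half θ).deriv

theorem deriv_proj_arc_two (θ : ℝ) :
    deriv (fun s : ℝ => proj (arc 2 s)) θ =
      Complex.exp ((2 * Real.pi - θ) * Complex.I) / 2 * Complex.I := by
  simp only [proj_arc_two]
  rw [((hasDerivAt_exp_half_sub θ).const_sub 1).deriv, neg_neg]

theorem deriv_proj_arc_three (θ : ℝ) :
    deriv (fun s : ℝ => proj (arc 3 s)) θ =
      -(Complex.exp ((2 * Real.pi - θ) * Complex.I) / 2 * Complex.I) := by
  simp only [proj_arc_three]
  exact (hasDerivAt_exp_half_sub θ).deriv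

/-- Pochhammer's contour splits into loops about `0` and about `1`. -/
theorem contourIntegral_eq (h : ℂ → ℂ) (z w : ℂ) :
    contourIntegral h z w =
      (Complex.exp (2 * Real.pi * Complex.I * z) - 1) * zeroLoop (fun t => h (1 - t)) w z -
      (1 - Complex.exp (2 * Real.pi * Complex.I * w)) * zeroLoop h z w := by
  -- Substituting 1 - t for t turns the circle about 1 into the circle about 0, exchanges z and w,
  -- and changes the sign of dt.
  have h0 : ∫ θ in (0 : ℝ)..(2 * Real.pi), h (proj (arc 0 θ)) * weight z w (arc 0 θ) *
      deriv (fun s : ℝ => proj (arc 0 s)) θ = -zeroLoop (fun t => h (1 - t)) w z := by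
    rw [zeroLoop, ← intervalIntegral.integral_neg]
    congr 1 with θ
    rw [proj_arc_zero, deriv_proj_arc_zero, zeroLoopIntegrand, weight, arc, mul_neg]
    congr 4
    ring
  have h1 : ∫ θ in (0 : ℝ)..(2 * Real.pi), h (proj (arc 1 θ)) * weight z w (arc 1 θ) *
      deriv (fun s : ℝ => proj (arc 1 s)) θ =
        Complex.exp (2 * Real.pi * Complex.I * w) * zeroLoop h z w := by
    rw [zeroLoop, ← intervalIntegral.integral_const_mul]
    congr 1 with θ
    rw [proj_arc_one, deriv_proj_arc_one, zeroLoopIntegrand, weight, arc]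
    simp only [mul_add, Complex.exp_add]
    ring_nf
  -- The third arc is the first one reversed, θ ↦ 2π - θ, on the sheet where log t has grown by 2πi;
  -- hence the factor e^{2πiz}.
  have h2 : ∫ θ in (0 : ℝ)..(2 * Real.pi), h (proj (arc 2 θ)) * weight z w (arc 2 θ) *
      deriv (fun s : ℝ => proj (arc 2 s)) θ =
        Complex.exp (2 * Real.pi * Complex.I * z) * zeroLoop (fun t => h (1 - t)) w z := by
    have e : zeroLoop (fun t => h (1 - t)) w z = ∫ θ in (0 : ℝ)..(2 * Real.pi),
        zeroLoopIntegrand (fun t => h (1 - t)) w z (2 * Real.pi - θ) := by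
      rw [intervalIntegral.integral_comp_sub_left]; simp [zeroLoop]
    rw [e, ← intervalIntegral.integral_const_mul]
    congr 1 with θ
    rw [proj_arc_two, deriv_proj_arc_two, zeroLoopIntegrand, weight, arc]
    push_cast
    simp only [mul_add, Complex.exp_add]
    ring_nf
  have h3 : ∫ θ in (0 : ℝ)..(2 * Real.pi), h (proj (arc 3 θ)) * weight z w (arc 3 θ) *
      deriv (fun s : ℝ => proj (arc 3 s)) θ = -zeroLoop h z w := by
    have e : zeroLoop h z w = ∫ θ in (0 : ℝ)..(2 * Real.pi),
        zeroLoopIntegrand h z w (2 * Real.pi - θ) := by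
      rw [intervalIntegral.integral_comp_sub_left]; simp [zeroLoop]
    rw [e, ← intervalIntegral.integral_neg]
    congr 1 with θ
    rw [proj_arc_three, deriv_proj_arc_three, zeroLoopIntegrand, weight, arc]
    push_cast
    ring
  rw [contourIntegral, Fin.sum_univ_four, h0, h1, h2, h3]
  ring

theorem one_sub_exp_ne_zero {z : ℂ} (hz : z ∈ nonIntegers) :
    1 - Complex.exp (2 * Real.pi * Complex.I * z) ≠ 0 := by
  intro h
  obtain ⟨n, hn⟩ := Complex.exp_eq_one_iff.1 (sub_eq_zero.1 h).symm
  refine hz ⟨n, ?_⟩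
  have h0 := Complex.two_pi_I_ne_zero
  exact mul_left_cancel₀ h0 (by rw [hn]; ring)

/-- Each factor of the normalization cancels against one of the loops, so that each summand keeps a
denominator in one parameter only. The two parameters can then be treated separately. -/
theorem normalizedIntegral_eq (h : ℂ → ℂ) {z w : ℂ} (hz : z ∈ nonIntegers)
    (hw : w ∈ nonIntegers) :
    normalizedIntegral h z w =
      zeroLoop h z w / (Complex.exp (2 * Real.pi * Complex.I * z) - 1) +
      zeroLoop (fun t => h (1 - t)) w z / (Complex.exp (2 * Real.pi * Complex.I * w) - 1) := by
  have h1 := one_sub_exp_ne_zero hz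
  have h2 := one_sub_exp_ne_zero hw
  have h1' : Complex.exp (2 * Real.pi * Complex.I * z) - 1 ≠ 0 := by
    rw [← neg_sub]; exact neg_ne_zero.2 h1
  have h2' : Complex.exp (2 * Real.pi * Complex.I * w) - 1 ≠ 0 := by
    rw [← neg_sub]; exact neg_ne_zero.2 h2
  rw [normalizedIntegral, contourIntegral_eq]
  field_simp
  ring

theorem continuous_zeroLoopIntegrand {h : ℂ → ℂ} (hh : Continuous h) :
    Continuous fun q : (ℂ × ℂ) × ℝ => zeroLoopIntegrand h q.1.1 q.1.2 q.2 := by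
  have hl : Continuous fun q : (ℂ × ℂ) × ℝ =>
      Complex.log (1 - Complex.exp (q.2 * Complex.I) / 2) :=
    Continuous.clog (by fun_prop) fun q => one_sub_mem_slitPlane q.2
  unfold zeroLoopIntegrand
  fun_prop

theorem continuous_zeroLoop {h : ℂ → ℂ} (hh : Continuous h) :
    Continuous fun p : ℂ × ℂ => zeroLoop h p.1 p.2 :=
  intervalIntegral.continuous_parametric_intervalIntegral_of_continuous'
    (continuous_zeroLoopIntegrand hh) _ _

/-! ### Collapsing a loop to a segment -/

/-- The Taylor expansion at `0` of a function holomorphic on the unit disc. -/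
theorem exists_hasSum_of_differentiableOn {f : ℂ → ℂ}
    (hf : DifferentiableOn ℂ f (Metric.ball 0 1)) :
    ∃ a : ℕ → ℂ, (∀ t ∈ Metric.ball (0 : ℂ) 1, HasSum (fun n => a n * t ^ n) (f t)) ∧
      Summable fun n => ‖a n‖ * (1 / 2 : ℝ) ^ n := by
  refine ⟨fun n => (n.factorial : ℂ)⁻¹ * iteratedDeriv n f 0, ?_, ?_⟩
  · intro t ht
    have := Complex.hasSum_taylorSeries_on_ball (c := 0) (r := 1) hf ht
    refine this.congr_fun ?_
    intro n
    simp only [sub_zero, smul_eq_mul]; ring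
  · have h2 : (1 / 2 : ℂ) ∈ Metric.ball (0 : ℂ) 1 := by simp; norm_num
    have := (Complex.hasSum_taylorSeries_on_ball (c := 0) (r := 1) hf h2).summable.norm
    refine this.congr fun n => ?_
    simp; ring

theorem norm_half_exp (θ : ℝ) : ‖Complex.exp (θ * Complex.I) / 2‖ = 1 / 2 := by
  rw [norm_div, Complex.norm_exp_ofReal_mul_I]; simp

theorem integral_exp_loop {c : ℂ} (hc : c ≠ 0) :
    ∫ θ in (0 : ℝ)..(2 * Real.pi),
      Complex.exp (c * (Complex.log (1 / 2) + θ * Complex.I)) * Complex.I =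
      (Complex.exp (2 * Real.pi * Complex.I * c) - 1) * ((1 / 2 : ℂ) ^ c / c) := by
  have hd : ∀ θ : ℝ, HasDerivAt
      (fun s : ℝ => Complex.exp (c * (Complex.log (1 / 2) + s * Complex.I)) / c)
      (Complex.exp (c * (Complex.log (1 / 2) + θ * Complex.I)) * Complex.I) θ := by
    intro θ
    have h := ((((Complex.ofRealCLM.hasDerivAt (x := θ)).mul_const Complex.I).const_add
      (Complex.log (1 / 2))).const_mul c).cexp.div_const c
    refine h.congr_deriv ?_
    simp
    field_simp
  rw [intervalIntegral.integral_eq_sub_of_hasDerivAt (fun θ _ => hd θ)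
    (Continuous.intervalIntegrable (by fun_prop) _ _),
    Complex.cpow_def_of_ne_zero (by norm_num)]
  simp only [mul_add, Complex.exp_add]
  push_cast
  simp
  ring_nf

theorem one_sub_mem_slitPlane_of_mem_ball {t : ℂ} (ht : t ∈ Metric.ball (0 : ℂ) 1) :
    1 - t ∈ Complex.slitPlane := by
  left
  have := (Complex.re_le_norm t).trans_lt (mem_ball_zero_iff.1 ht)
  simpa using this

/-- With h(t)(1-t)^w = Σ a_n t^n, both sides become sums of integrals of t^{z+n}. Once around the
loop the primitive t^{z+n+1}/(z+n+1) is multiplied by e^{2πi(z+n+1)} = e^{2πiz}, a factor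
independent of n; on the segment it vanishes at 0 because Re z > -1. -/
theorem zeroLoop_eq_mul_halfIntegral {h : ℂ → ℂ} (hh : Differentiable ℂ h) {z : ℂ}
    (hz : -1 < z.re) (w : ℂ) :
    zeroLoop h z w = (Complex.exp (2 * Real.pi * Complex.I * z) - 1) * halfIntegral h z w := by
  have hf : DifferentiableOn ℂ (fun t => h t * (1 - t) ^ w) (Metric.ball 0 1) := by
    intro t ht
    exact (hh.differentiableAt.mul (((differentiableAt_const _).sub differentiableAt_id).cpow
      (differentiableAt_const _) (one_sub_mem_slitPlane_of_mem_ball ht))).differentiableWithinAt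
  obtain ⟨a, ha, hs⟩ := exists_hasSum_of_differentiableOn hf
  have hc : ∀ n : ℕ, z + n + 1 ≠ 0 := by
    intro n hn
    have := congrArg Complex.re hn
    simp at this
    have h0 : (0 : ℝ) ≤ n := n.cast_nonneg
    linarith
  -- The 1 in the exponent z + n + 1 comes from dt = i t dθ.
  have loop : HasSum (fun n : ℕ => ∫ θ in (0 : ℝ)..(2 * Real.pi), a n *
      (Complex.exp ((z + n + 1) * (Complex.log (1 / 2) + θ * Complex.I)) * Complex.I))
      (zeroLoop h z w) := by
    have hcont : Continuous fun θ : ℝ => Complex.exp (z * (Complex.log (1 / 2) + θ * Complex.I)) *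
      (Complex.exp (θ * Complex.I) / 2 * Complex.I) := by fun_prop
    have hterm : ∀ (n : ℕ) (θ : ℝ), a n *
        (Complex.exp ((z + n + 1) * (Complex.log (1 / 2) + θ * Complex.I)) * Complex.I) =
        a n * (Complex.exp (θ * Complex.I) / 2) ^ n *
        (Complex.exp (z * (Complex.log (1 / 2) + θ * Complex.I)) *
          (Complex.exp (θ * Complex.I) / 2 * Complex.I)) := by
      intro n θ
      have : Complex.exp (θ * Complex.I) / 2 =
          Complex.exp (Complex.log (1 / 2) + θ * Complex.I) := by
        rw [Complex.exp_add, exp_log_half]; ring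
      rw [this, ← Complex.exp_nat_mul, add_mul, add_mul, one_mul, Complex.exp_add,
        Complex.exp_add]
      ring
    refine intervalIntegral.hasSum_integral_of_dominated_convergence
      (fun n θ => ‖a n‖ * (1 / 2 : ℝ) ^ n *
        ‖Complex.exp (z * (Complex.log (1 / 2) + θ * Complex.I)) *
      (Complex.exp (θ * Complex.I) / 2 * Complex.I)‖) ?_ ?_ ?_ ?_ ?_
    · intro n
      exact Continuous.aestronglyMeasurable (by fun_prop)
    · intro n
      refine Eventually.of_forall fun θ _ => ?_
      rw [hterm, norm_mul, norm_mul, norm_pow, norm_half_exp]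
    · exact Eventually.of_forall fun θ _ => hs.mul_right _
    · simp_rw [tsum_mul_right]
      exact Continuous.intervalIntegrable (by fun_prop) _ _
    · refine Eventually.of_forall fun θ _ => ?_
      have hm : Complex.exp (θ * Complex.I) / 2 ∈ Metric.ball (0 : ℂ) 1 := by
        rw [mem_ball_zero_iff, norm_half_exp]; norm_num
      have := (ha _ hm).mul_right (Complex.exp (z * (Complex.log (1 / 2) + θ * Complex.I)) *
          (Complex.exp (θ * Complex.I) / 2 * Complex.I))
      suffices hv : zeroLoopIntegrand h z w θ =
          h (Complex.exp (θ * Complex.I) / 2) * (1 - Complex.exp (θ * Complex.I) / 2) ^ w *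
          (Complex.exp (z * (Complex.log (1 / 2) + θ * Complex.I)) *
            (Complex.exp (θ * Complex.I) / 2 * Complex.I)) by
        simp_rw [hterm]
        rwa [hv]
      rw [zeroLoopIntegrand, Complex.exp_add,
        Complex.cpow_def_of_ne_zero (Complex.slitPlane_ne_zero (one_sub_mem_slitPlane θ)),
        mul_comm w]
      ring
  have seg : HasSum (fun n : ℕ => ∫ x in (0 : ℝ)..(1 / 2), a n * (x : ℂ) ^ (z + n))
      (halfIntegral h z w) := by
    have hterm : ∀ (n : ℕ) (x : ℝ), 0 < x → a n * (x : ℂ) ^ (z + n) =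
        a n * (x : ℂ) ^ n * (x : ℂ) ^ z := by
      intro n x hx
      rw [Complex.cpow_add _ _ (by exact_mod_cast hx.ne'), Complex.cpow_natCast]
      ring
    have hI : Set.uIoc (0 : ℝ) (1 / 2) = Set.Ioc 0 (1 / 2) := Set.uIoc_of_le (by norm_num)
    refine intervalIntegral.hasSum_integral_of_dominated_convergence
      (fun n x => ‖a n‖ * (1 / 2 : ℝ) ^ n * ‖(x : ℂ) ^ z‖) ?_ ?_ ?_ ?_ ?_
    · intro n
      rw [hI]
      refine ContinuousOn.aestronglyMeasurable ?_ measurableSet_Ioc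
      refine continuousOn_const.mul (ContinuousOn.cpow_const (by fun_prop) ?_)
      intro x hx
      exact Or.inl (by simpa using hx.1)
    · intro n
      refine Eventually.of_forall fun x hx => ?_
      rw [hI] at hx
      rw [hterm n x hx.1, norm_mul, norm_mul, norm_pow, Complex.norm_of_nonneg hx.1.le]
      gcongr
      exact hx.1.le
      exact hx.2
    · exact Eventually.of_forall fun θ _ => hs.mul_right _
    · simp_rw [tsum_mul_right]
      exact (intervalIntegral.intervalIntegrable_cpow' hz).norm.const_mul _
    · refine Eventually.of_forall fun x hx => ?_
      rw [hI] at hx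
      have hm : (x : ℂ) ∈ Metric.ball (0 : ℂ) 1 := by
        rw [mem_ball_zero_iff, Complex.norm_of_nonneg hx.1.le]; linarith [hx.2]
      simp_rw [hterm _ x hx.1]
      rw [show h x * ((x : ℂ) ^ z * (1 - (x : ℂ)) ^ w) =
        h x * (1 - (x : ℂ)) ^ w * (x : ℂ) ^ z by ring]
      exact (ha _ hm).mul_right ((x : ℂ) ^ z)
  refine loop.unique ?_
  refine (seg.mul_left (Complex.exp (2 * Real.pi * Complex.I * z) - 1)).congr_fun fun n => ?_
  rw [intervalIntegral.integral_const_mul, intervalIntegral.integral_const_mul,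
    integral_exp_loop (hc n), integral_cpow (Or.inl ?_)]
  · have e : Complex.exp (2 * Real.pi * Complex.I * (z + n + 1)) =
        Complex.exp (2 * Real.pi * Complex.I * z) := by
      rw [show 2 * Real.pi * Complex.I * (z + n + 1) =
        2 * Real.pi * Complex.I * z + ((n + 1 : ℕ) : ℂ) * (2 * Real.pi * Complex.I) by
          push_cast; ring, Complex.exp_add, Complex.exp_nat_mul_two_pi_mul_I, mul_one]
    rw [e]
    simp [Complex.zero_cpow (hc n)]
    ring
  · have h0 : (0 : ℝ) ≤ n := n.cast_nonneg
    simp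
    linarith

theorem continuousAt_halfIntegral {h : ℂ → ℂ} (hh : Continuous h) {α β : ℂ} (hα : -1 < α.re) :
    ContinuousAt (fun p : ℂ × ℂ => halfIntegral h p.1 p.2) (α, β) := by
  have hI : Set.uIoc (0 : ℝ) (1 / 2) = Set.Ioc 0 (1 / 2) := Set.uIoc_of_le (by norm_num)
  have hs : ∀ x ∈ Set.Icc (0 : ℝ) (1 / 2), 1 - (x : ℂ) ∈ Complex.slitPlane := by
    intro x hx
    left
    simp
    linarith [hx.2]
  -- M bounds the factor without singularity on [0, 1/2], uniformly for w in the closed unit ball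
  -- about β. With c strictly between -1 and Re α, M x^c is then an integrable bound for all (z, w)
  -- near (α, β).
  obtain ⟨M, hM⟩ := ((isCompact_closedBall β 1).prod
    (isCompact_Icc (a := (0 : ℝ)) (b := 1 / 2))).exists_bound_of_continuousOn
    (f := fun q : ℂ × ℝ => h q.2 * (1 - (q.2 : ℂ)) ^ q.1) (by
      refine ContinuousOn.mul (by fun_prop) (ContinuousOn.cpow (by fun_prop) (by fun_prop) ?_)
      exact fun q hq => hs _ hq.2)
  obtain ⟨c, hc1, hc2⟩ := exists_between hα
  refine intervalIntegral.continuousAt_of_dominated_interval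
    (bound := fun x => M * x ^ c) ?_ ?_ ?_ ?_
  · refine Eventually.of_forall fun p => ?_
    rw [hI]
    refine ContinuousOn.aestronglyMeasurable ?_ measurableSet_Ioc
    refine ContinuousOn.mul (by fun_prop) (ContinuousOn.mul
      (ContinuousOn.cpow_const (by fun_prop) ?_) (ContinuousOn.cpow_const (by fun_prop) ?_))
    · intro x hx
      exact Or.inl (by simpa using hx.1)
    · exact fun x hx => hs x ⟨hx.1.le, hx.2⟩
  · have e1 : ∀ᶠ p : ℂ × ℂ in 𝓝 (α, β), c < p.1.re :=
      (Complex.continuous_re.comp continuous_fst).continuousAt.tendsto.eventually_const_lt hc2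
    have e2 : ∀ᶠ p : ℂ × ℂ in 𝓝 (α, β), p.2 ∈ Metric.closedBall β 1 :=
      continuous_snd.continuousAt.eventually_mem (Metric.closedBall_mem_nhds β one_pos)
    filter_upwards [e1, e2] with p h1 h2
    refine Eventually.of_forall fun x hx => ?_
    rw [hI] at hx
    have := hM (p.2, x) ⟨h2, hx.1.le, hx.2⟩
    rw [mul_left_comm, norm_mul, mul_comm M, Complex.norm_cpow_eq_rpow_re_of_pos hx.1]
    have hx1 : x ≤ 1 := by linarith [hx.2]
    gcongr ?_ * ?_
    · exact Real.rpow_nonneg hx.1.le _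
    · exact Real.rpow_le_rpow_of_exponent_ge hx.1 hx1 h1.le
  · exact (intervalIntegral.intervalIntegrable_rpow' hc1).const_mul _
  · refine Eventually.of_forall fun x hx => ?_
    rw [hI] at hx
    have hx0 : (x : ℂ) ≠ 0 := by exact_mod_cast hx.1.ne'
    have hx2 := Complex.slitPlane_ne_zero (hs x ⟨hx.1.le, hx.2⟩)
    exact (continuous_const.mul ((continuous_fst.const_cpow (Or.inl hx0)).mul
      (continuous_snd.const_cpow (Or.inl hx2)))).continuousAt

/-! ### Existence of the limit -/

theorem paramFilter_le (α β : ℂ) : paramFilter α β ≤ 𝓝 (α, β) := by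
  rw [nhds_prod_eq]
  exact Filter.prod_mono nhdsWithin_le_nhds nhdsWithin_le_nhds

theorem eventually_mem_nonIntegers (α β : ℂ) :
    ∀ᶠ p in paramFilter α β, p.1 ∈ nonIntegers ∧ p.2 ∈ nonIntegers :=
  (eventually_mem_nhdsWithin).prod_mk eventually_mem_nhdsWithin

/-- The complement of a countable set is dense in ℂ. Nontriviality of the filter makes its limits
unique, so that `limUnder` can be evaluated. -/
instance neBot_nhdsWithin_nonIntegers (α : ℂ) : (𝓝[nonIntegers] α).NeBot :=
  mem_closure_iff_nhdsWithin_neBot.1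
    (((Set.countable_range ((↑) : ℤ → ℂ)).dense_compl ℝ).closure_eq ▸ Set.mem_univ α)

instance neBot_paramFilter (α β : ℂ) : (paramFilter α β).NeBot := by
  unfold paramFilter; infer_instance

/-- This is where the exclusion of negative integers enters: outside the half-plane Re α > -1 the
denominator e^{2πiα} - 1 cannot vanish. -/
theorem mem_nonIntegers_of_re_le {α : ℂ} (hα : ∀ k : ℕ, α ≠ -((k : ℂ) + 1)) (h : α.re ≤ -1) :
    α ∈ nonIntegers := by
  rintro ⟨n, rfl⟩
  have hn : n ≤ -1 := by
    have : (n : ℝ) ≤ -1 := by simpa using h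
    exact_mod_cast this
  refine hα (-n - 1).toNat ?_
  have : (((-n - 1).toNat : ℤ) : ℂ) = ((-n - 1 : ℤ) : ℂ) := by
    rw [Int.toNat_of_nonneg (by omega)]
  rw [Int.cast_natCast] at this
  rw [this]
  push_cast
  ring

theorem tendsto_zeroLoop_div_of_re {h : ℂ → ℂ} (hh : Differentiable ℂ h) {α β : ℂ}
    (hα : -1 < α.re) :
    Tendsto (fun p : ℂ × ℂ =>
      zeroLoop h p.1 p.2 / (Complex.exp (2 * Real.pi * Complex.I * p.1) - 1))
      (paramFilter α β) (𝓝 (halfIntegral h α β)) := by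
  refine ((continuousAt_halfIntegral hh.continuous (β := β) hα).tendsto.mono_left
    (paramFilter_le α β)).congr' ?_
  have e1 : ∀ᶠ p : ℂ × ℂ in paramFilter α β, -1 < p.1.re :=
    ((Complex.continuous_re.comp continuous_fst).continuousAt.tendsto.eventually_const_lt hα).filter_mono
      (paramFilter_le α β)
  filter_upwards [e1, eventually_mem_nonIntegers α β] with p h1 h2
  have := one_sub_exp_ne_zero h2.1
  have h' : Complex.exp (2 * Real.pi * Complex.I * p.1) - 1 ≠ 0 := by
    rw [← neg_sub]; exact neg_ne_zero.2 this
  rw [zeroLoop_eq_mul_halfIntegral hh h1, mul_div_cancel_left₀ _ h']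

/-- For Re α > -1 the zeros of the denominator are cancelled by the collapse to a segment; otherwise
the denominator is nonzero at α and the quotient is continuous there. -/
theorem exists_tendsto_zeroLoop_div {h : ℂ → ℂ} (hh : Differentiable ℂ h) {α : ℂ} (β : ℂ)
    (hα : ∀ k : ℕ, α ≠ -((k : ℂ) + 1)) :
    ∃ l, Tendsto (fun p : ℂ × ℂ =>
      zeroLoop h p.1 p.2 / (Complex.exp (2 * Real.pi * Complex.I * p.1) - 1))
      (paramFilter α β) (𝓝 l) := by
  by_cases hr : -1 < α.re
  · exact ⟨_, tendsto_zeroLoop_div_of_re hh hr⟩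
  · have := one_sub_exp_ne_zero (mem_nonIntegers_of_re_le hα (not_lt.1 hr))
    have h' : Complex.exp (2 * Real.pi * Complex.I * α) - 1 ≠ 0 := by
      rw [← neg_sub]; exact neg_ne_zero.2 this
    have hc : ContinuousAt (fun p : ℂ × ℂ =>
        zeroLoop h p.1 p.2 / (Complex.exp (2 * Real.pi * Complex.I * p.1) - 1)) (α, β) :=
      (continuous_zeroLoop hh.continuous).continuousAt.div
        (Continuous.continuousAt (by fun_prop)) h'
    exact ⟨_, hc.tendsto.mono_left (paramFilter_le α β)⟩

theorem tendsto_swap_paramFilter (α β : ℂ) :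
    Tendsto Prod.swap (paramFilter α β) (paramFilter β α) :=
  tendsto_snd.prodMk tendsto_fst

theorem tendsto_normalizedIntegral {h : ℂ → ℂ} {α β l₀ l₁ : ℂ}
    (h0 : Tendsto (fun p : ℂ × ℂ =>
      zeroLoop h p.1 p.2 / (Complex.exp (2 * Real.pi * Complex.I * p.1) - 1))
      (paramFilter α β) (𝓝 l₀))
    (h1 : Tendsto (fun p : ℂ × ℂ =>
      zeroLoop (fun t => h (1 - t)) p.1 p.2 /
        (Complex.exp (2 * Real.pi * Complex.I * p.1) - 1)) (paramFilter β α) (𝓝 l₁)) :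
    Tendsto (fun p : ℂ × ℂ => normalizedIntegral h p.1 p.2) (paramFilter α β) (𝓝 (l₀ + l₁)) := by
  refine (h0.add (h1.comp (tendsto_swap_paramFilter α β))).congr' ?_
  filter_upwards [eventually_mem_nonIntegers α β] with p hp
  rw [normalizedIntegral_eq h hp.1 hp.2]
  rfl

theorem tendsto_jacobiMeasure {h : ℂ → ℂ} (hh : Differentiable ℂ h) {α β : ℂ}
    (hα : ∀ k : ℕ, α ≠ -((k : ℂ) + 1)) (hβ : ∀ k : ℕ, β ≠ -((k : ℂ) + 1)) :
    Tendsto (fun p : ℂ × ℂ => normalizedIntegral h p.1 p.2) (paramFilter α β)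
      (𝓝 (jacobiMeasure α β h)) := by
  obtain ⟨l₀, h0⟩ := exists_tendsto_zeroLoop_div hh β hα
  obtain ⟨l₁, h1⟩ := exists_tendsto_zeroLoop_div (h := fun t => h (1 - t)) (by fun_prop) α hβ
  exact tendsto_nhds_limUnder ⟨_, tendsto_normalizedIntegral h0 h1⟩

theorem jacobiMeasure_eq_of_tendsto {h : ℂ → ℂ} {α β l : ℂ}
    (hl : Tendsto (fun p : ℂ × ℂ => normalizedIntegral h p.1 p.2) (paramFilter α β) (𝓝 l)) :
    jacobiMeasure α β h = l :=
  hl.limUnder_eq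

/-! ### Agreement with the classical integral -/

theorem intervalIntegrable_jacobi_half {h : ℂ → ℂ} (hh : Continuous h) {α : ℂ} (β : ℂ)
    (hα : -1 < α.re) :
    IntervalIntegrable (fun x : ℝ => h x * ((x : ℂ) ^ α * (1 - (x : ℂ)) ^ β))
      MeasureTheory.volume 0 (1 / 2) := by
  have := Complex.betaIntegral_convergent_left (u := α + 1) (by simp; linarith) (β + 1)
  simp only [add_sub_cancel_right] at this
  exact this.continuousOn_mul (by fun_prop)

theorem jacobiMeasure_eq_integral {h : ℂ → ℂ} (hh : Differentiable ℂ h) {α β : ℂ}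
    (hα : -1 < α.re) (hβ : -1 < β.re) :
    jacobiMeasure α β h = ∫ x in (0 : ℝ)..1, h x * ((x : ℂ) ^ α * (1 - (x : ℂ)) ^ β) := by
  have hh' : Differentiable ℂ fun t => h (1 - t) := by fun_prop
  rw [jacobiMeasure_eq_of_tendsto (tendsto_normalizedIntegral
    (tendsto_zeroLoop_div_of_re hh hα) (tendsto_zeroLoop_div_of_re hh' hβ))]
  have i0 := intervalIntegrable_jacobi_half hh.continuous β hα
  have i1 := ((intervalIntegrable_jacobi_half hh'.continuous α hβ).comp_sub_left 1).symm
  have e : halfIntegral (fun t => h (1 - t)) β α =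
      ∫ x in (1 / 2 : ℝ)..1, h x * ((x : ℂ) ^ α * (1 - (x : ℂ)) ^ β) := by
    have := intervalIntegral.integral_comp_sub_left (a := 1 / 2) (b := 1)
      (fun x : ℝ => h (1 - x) * ((x : ℂ) ^ β * (1 - (x : ℂ)) ^ α)) 1
    rw [halfIntegral]
    norm_num at this ⊢
    rw [← this]
    congr 1 with x
    ring
  rw [e, halfIntegral]
  refine intervalIntegral.integral_add_adjacent_intervals i0 ?_
  norm_num at i1
  refine i1.congr fun x _ => ?_
  ring

/-! ### Linearity and parameter shifts -/

theorem continuous_deriv_proj_arc (k : Fin 4) :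
    Continuous (deriv fun s : ℝ => proj (arc k s)) := by
  fin_cases k
  · exact Continuous.congr (by fun_prop) fun θ => (deriv_proj_arc_zero θ).symm
  · exact Continuous.congr (by fun_prop) fun θ => (deriv_proj_arc_one θ).symm
  · exact Continuous.congr (by fun_prop) fun θ => (deriv_proj_arc_two θ).symm
  · exact Continuous.congr (by fun_prop) fun θ => (deriv_proj_arc_three θ).symm

theorem continuous_contour_integrand {h : ℂ → ℂ} (hh : Continuous h) (z w : ℂ) (k : Fin 4) :
    Continuous fun θ : ℝ => h (proj (arc k θ)) * weight z w (arc k θ) *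
      deriv (fun s : ℝ => proj (arc k s)) θ := by
  have h1 := (arc_differentiable k).continuous
  have h2 := continuous_deriv_proj_arc k
  unfold proj weight at *
  fun_prop

theorem contourIntegral_sum {ι : Type*} (s : Finset ι) (c : ι → ℂ) {f : ι → ℂ → ℂ}
    (hf : ∀ i, Continuous (f i)) (z w : ℂ) :
    contourIntegral (fun t => ∑ i ∈ s, c i * f i t) z w =
      ∑ i ∈ s, c i * contourIntegral (f i) z w := by
  simp only [contourIntegral, Finset.mul_sum]
  rw [Finset.sum_comm]
  refine Finset.sum_congr rfl fun k _ => ?_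
  simp only [Finset.sum_mul, ← intervalIntegral.integral_const_mul]
  rw [← intervalIntegral.integral_finsetSum]
  · congr 1 with θ
    refine Finset.sum_congr rfl fun i _ => ?_
    ring
  · intro i _
    exact ((continuous_contour_integrand (hf i) z w k).const_mul _).intervalIntegrable _ _

theorem normalizedIntegral_sum {ι : Type*} (s : Finset ι) (c : ι → ℂ) {f : ι → ℂ → ℂ}
    (hf : ∀ i, Continuous (f i)) (z w : ℂ) :
    normalizedIntegral (fun t => ∑ i ∈ s, c i * f i t) z w =
      ∑ i ∈ s, c i * normalizedIntegral (f i) z w := by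
  rw [normalizedIntegral, contourIntegral_sum s c hf, Finset.mul_sum]
  refine Finset.sum_congr rfl fun i _ => ?_
  rw [normalizedIntegral]
  ring

theorem jacobiMeasure_sum {ι : Type*} (s : Finset ι) (c : ι → ℂ) {f : ι → ℂ → ℂ}
    (hf : ∀ i, Differentiable ℂ (f i)) {α β : ℂ}
    (hα : ∀ k : ℕ, α ≠ -((k : ℂ) + 1)) (hβ : ∀ k : ℕ, β ≠ -((k : ℂ) + 1)) :
    jacobiMeasure α β (fun t => ∑ i ∈ s, c i * f i t) =
      ∑ i ∈ s, c i * jacobiMeasure α β (f i) := by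
  refine jacobiMeasure_eq_of_tendsto ?_
  simp only [normalizedIntegral_sum s c fun i => (hf i).continuous]
  exact tendsto_finsetSum _ fun i _ => (tendsto_jacobiMeasure (hf i) hα hβ).const_mul _

theorem proj_mul_weight (z w : ℂ) (p : ℂ × ℂ) : proj p * weight z w p = weight (z + 1) w p := by
  rw [proj, weight, weight, ← Complex.exp_add]
  ring_nf

theorem one_sub_proj_mul_weight (z w : ℂ) {p : ℂ × ℂ} (hp : p ∈ surface) :
    (1 - proj p) * weight z w p = weight z (w + 1) p := by
  have : 1 - proj p = Complex.exp p.2 := sub_eq_of_eq_add' (Eq.symm hp)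
  rw [this, weight, weight, ← Complex.exp_add]
  ring_nf

theorem exp_two_pi_mul_add_one (z : ℂ) :
    Complex.exp (2 * Real.pi * Complex.I * (z + 1)) =
      Complex.exp (2 * Real.pi * Complex.I * z) := by
  rw [mul_add, mul_one, Complex.exp_add, Complex.exp_two_pi_mul_I, mul_one]

/-- The factor t is absorbed into the weight, and the normalization has period 1 in z. -/
theorem normalizedIntegral_mul_id (h : ℂ → ℂ) (z w : ℂ) :
    normalizedIntegral (fun t => t * h t) z w = normalizedIntegral h (z + 1) w := by
  rw [normalizedIntegral, normalizedIntegral, exp_two_pi_mul_add_one, contourIntegral,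
    contourIntegral]
  simp only [← proj_mul_weight, mul_assoc, mul_left_comm (proj _)]

theorem normalizedIntegral_mul_one_sub (h : ℂ → ℂ) (z w : ℂ) :
    normalizedIntegral (fun t => (1 - t) * h t) z w = normalizedIntegral h z (w + 1) := by
  rw [normalizedIntegral, normalizedIntegral, exp_two_pi_mul_add_one, contourIntegral,
    contourIntegral]
  simp only [← one_sub_proj_mul_weight _ _ (arc_mem_surface _ _), mul_assoc,
    mul_left_comm (1 - proj _)]

theorem tendsto_add_one_nhdsWithin (α : ℂ) :
    Tendsto (fun z : ℂ => z + 1) (𝓝[nonIntegers] α) (𝓝[nonIntegers] (α + 1)) := by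
  refine tendsto_nhdsWithin_iff.2 ⟨(Continuous.tendsto (by fun_prop) α).mono_left
    nhdsWithin_le_nhds, ?_⟩
  filter_upwards [self_mem_nhdsWithin] with z hz
  rintro ⟨n, hn⟩
  exact hz ⟨n - 1, by push_cast; rw [hn]; ring⟩

theorem ne_neg_add_nat {α : ℂ} (hα : ∀ k : ℕ, α ≠ -((k : ℂ) + 1)) (j : ℕ) (k : ℕ) :
    α + j ≠ -((k : ℂ) + 1) := by
  intro h
  refine hα (k + j) ?_
  push_cast
  linear_combination h

theorem ne_neg_add_one {α : ℂ} (hα : ∀ k : ℕ, α ≠ -((k : ℂ) + 1)) (k : ℕ) :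
    α + 1 ≠ -((k : ℂ) + 1) := by
  simpa using ne_neg_add_nat hα 1 k

theorem jacobiMeasure_mul_id {h : ℂ → ℂ} (hh : Differentiable ℂ h) {α β : ℂ}
    (hα : ∀ k : ℕ, α ≠ -((k : ℂ) + 1)) (hβ : ∀ k : ℕ, β ≠ -((k : ℂ) + 1)) :
    jacobiMeasure α β (fun t => t * h t) = jacobiMeasure (α + 1) β h := by
  refine jacobiMeasure_eq_of_tendsto ?_
  simp only [normalizedIntegral_mul_id]
  have ht : Tendsto (fun p : ℂ × ℂ => (p.1 + 1, p.2)) (paramFilter α β)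
      (paramFilter (α + 1) β) :=
    ((tendsto_add_one_nhdsWithin α).comp tendsto_fst).prodMk tendsto_snd
  simpa only [Function.comp_def] using
    (tendsto_jacobiMeasure hh (ne_neg_add_one hα) hβ).comp ht

theorem jacobiMeasure_mul_one_sub {h : ℂ → ℂ} (hh : Differentiable ℂ h) {α β : ℂ}
    (hα : ∀ k : ℕ, α ≠ -((k : ℂ) + 1)) (hβ : ∀ k : ℕ, β ≠ -((k : ℂ) + 1)) :
    jacobiMeasure α β (fun t => (1 - t) * h t) = jacobiMeasure α (β + 1) h := by
  refine jacobiMeasure_eq_of_tendsto ?_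
  simp only [normalizedIntegral_mul_one_sub]
  have ht : Tendsto (fun p : ℂ × ℂ => (p.1, p.2 + 1)) (paramFilter α β)
      (paramFilter α (β + 1)) :=
    tendsto_fst.prodMk ((tendsto_add_one_nhdsWithin β).comp tendsto_snd)
  simpa only [Function.comp_def] using
    (tendsto_jacobiMeasure hh hα (ne_neg_add_one hβ)).comp ht

/-! ### Integration by parts and the total mass -/

/-- With u = log t and v = log(1-t), differentiating e^u + e^v = 1 along the arc gives dt = e^u du =
-e^v dv, which turns the derivative of (z+1)u + (w+1)v into a multiple of dt. -/
theorem hasDerivAt_weight_arc (z w : ℂ) (k : Fin 4) (θ : ℝ) :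
    HasDerivAt (fun s : ℝ => weight (z + 1) (w + 1) (arc k s))
      (((z + 1) * (1 - proj (arc k θ)) - (w + 1) * proj (arc k θ)) * weight z w (arc k θ) *
        deriv (fun s : ℝ => proj (arc k s)) θ) θ := by
  have hd := (arc_differentiable k θ).hasDerivAt
  have hu : HasDerivAt (fun s : ℝ => (arc k s).1) (deriv (arc k) θ).1 θ :=
    (ContinuousLinearMap.fst ℝ ℂ ℂ).hasFDerivAt.comp_hasDerivAt θ hd
  have hv : HasDerivAt (fun s : ℝ => (arc k s).2) (deriv (arc k) θ).2 θ :=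
    (ContinuousLinearMap.snd ℝ ℂ ℂ).hasFDerivAt.comp_hasDerivAt θ hd
  have hs : ∀ s, Complex.exp (arc k s).1 + Complex.exp (arc k s).2 = 1 :=
    fun s => arc_mem_surface k s
  have hz : Complex.exp (arc k θ).1 * (deriv (arc k) θ).1 +
      Complex.exp (arc k θ).2 * (deriv (arc k) θ).2 = 0 := by
    refine (hu.cexp.add hv.cexp).unique ?_
    exact (hasDerivAt_const θ (1 : ℂ)).congr_of_eventuallyEq (Eventually.of_forall hs)
  have hp : deriv (fun s : ℝ => proj (arc k s)) θ =
      Complex.exp (arc k θ).1 * (deriv (arc k) θ).1 := hu.cexp.deriv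
  refine ((hu.const_mul (z + 1)).add (hv.const_mul (w + 1))).cexp.congr_deriv ?_
  have e : Complex.exp ((z + 1) * (arc k θ).1 + (w + 1) * (arc k θ).2) =
      weight z w (arc k θ) * (Complex.exp (arc k θ).1 * Complex.exp (arc k θ).2) := by
    rw [weight, ← Complex.exp_add, ← Complex.exp_add]
    ring_nf
  rw [hp, Pi.add_apply, e, proj]
  linear_combination weight z w (arc k θ) * Complex.exp (arc k θ).1 * (w + 1) * hz +
    weight z w (arc k θ) * Complex.exp (arc k θ).1 * (deriv (arc k) θ).1 * (z + 1) * hs θ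

/-- The integrand is an exact derivative, and its boundary values cancel cyclically because the
lifted contour is closed. -/
theorem contourIntegral_deriv_weight (z w : ℂ) :
    contourIntegral (fun t => (z + 1) * (1 - t) - (w + 1) * t) z w = 0 := by
  have h : ∀ k : Fin 4, ∫ θ in (0 : ℝ)..(2 * Real.pi),
      ((z + 1) * (1 - proj (arc k θ)) - (w + 1) * proj (arc k θ)) * weight z w (arc k θ) *
        deriv (fun s : ℝ => proj (arc k s)) θ =
      weight (z + 1) (w + 1) (arc (k + 1) 0) - weight (z + 1) (w + 1) (arc k 0) := by
    intro k
    rw [intervalIntegral.integral_eq_sub_of_hasDerivAt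
      (fun θ _ => hasDerivAt_weight_arc z w k θ), arc_closed]
    exact (continuous_contour_integrand (h := fun t => (z + 1) * (1 - t) - (w + 1) * t)
      (by fun_prop) z w k).intervalIntegrable _ _
  simp only [contourIntegral, h, Finset.sum_sub_distrib]
  exact sub_eq_zero.2 (Equiv.sum_comp (Equiv.addRight (1 : Fin 4))
    fun k => weight (z + 1) (w + 1) (arc k 0))

/-- The total mass of `μ^{(α,β)}`. -/
noncomputable def mass (α β : ℂ) : ℂ := jacobiMeasure α β fun _ => 1

theorem normalizedIntegral_recurrence (z w : ℂ) :
    (z + 1) * normalizedIntegral (fun _ => 1) z w =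
      (z + w + 2) * normalizedIntegral (fun t => t) z w := by
  have h := normalizedIntegral_sum (Finset.univ : Finset (Fin 2)) ![z + 1, -(z + w + 2)]
    (f := ![fun _ => 1, fun t => t]) (by intro i; fin_cases i <;> simp <;> fun_prop) z w
  have h0 : normalizedIntegral (fun t => (z + 1) * (1 - t) - (w + 1) * t) z w = 0 := by
    rw [normalizedIntegral, contourIntegral_deriv_weight, mul_zero]
  simp only [Fin.sum_univ_two, Matrix.cons_val_zero, Matrix.cons_val_one] at h
  rw [show (fun t : ℂ => (z + 1) * 1 + -(z + w + 2) * t) =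
    fun t => (z + 1) * (1 - t) - (w + 1) * t by funext t; ring, h0] at h
  linear_combination -h

theorem jacobiMeasure_recurrence {α β : ℂ}
    (hα : ∀ k : ℕ, α ≠ -((k : ℂ) + 1)) (hβ : ∀ k : ℕ, β ≠ -((k : ℂ) + 1)) :
    (α + 1) * mass α β = (α + β + 2) * jacobiMeasure α β fun t => t := by
  have t1 : Tendsto (fun p : ℂ × ℂ => p.1) (paramFilter α β) (𝓝 α) :=
    (continuous_fst.tendsto (α, β)).mono_left (paramFilter_le α β)
  have t2 : Tendsto (fun p : ℂ × ℂ => p.2) (paramFilter α β) (𝓝 β) :=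
    (continuous_snd.tendsto (α, β)).mono_left (paramFilter_le α β)
  refine tendsto_nhds_unique ((t1.add_const 1).mul
    (tendsto_jacobiMeasure (h := fun _ => 1) (by fun_prop) hα hβ)) ?_
  simp only [normalizedIntegral_recurrence]
  exact ((t1.add t2).add_const 2).mul
    (tendsto_jacobiMeasure (h := fun t => t) (by fun_prop) hα hβ)

theorem mass_add_one_left {α β : ℂ}
    (hα : ∀ k : ℕ, α ≠ -((k : ℂ) + 1)) (hβ : ∀ k : ℕ, β ≠ -((k : ℂ) + 1)) :
    (α + 1) * mass α β = (α + β + 2) * mass (α + 1) β := by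
  have := jacobiMeasure_mul_id (h := fun _ => 1) (by fun_prop) hα hβ
  simp only [mul_one] at this
  rw [jacobiMeasure_recurrence hα hβ, this, mass]

theorem mass_add_one_right {α β : ℂ}
    (hα : ∀ k : ℕ, α ≠ -((k : ℂ) + 1)) (hβ : ∀ k : ℕ, β ≠ -((k : ℂ) + 1)) :
    (β + 1) * mass α β = (α + β + 2) * mass α (β + 1) := by
  have h1 := jacobiMeasure_mul_one_sub (h := fun _ => 1) (by fun_prop) hα hβ
  simp only [mul_one] at h1
  have h := jacobiMeasure_sum (Finset.univ : Finset (Fin 2)) ![1, -1]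
    (f := ![fun _ => 1, fun t => t]) (by intro i; fin_cases i <;> simp) hα hβ
  simp only [Fin.sum_univ_two, Matrix.cons_val_zero, Matrix.cons_val_one] at h
  rw [show (fun t : ℂ => (1 : ℂ) * 1 + -1 * t) = fun t => 1 - t by funext t; ring, h1] at h
  have h2 := jacobiMeasure_recurrence hα hβ
  unfold mass at *
  linear_combination -(α + β + 2) * h - h2

theorem add_one_ne_zero_of_ne {α : ℂ} (hα : ∀ k : ℕ, α ≠ -((k : ℂ) + 1)) : α + 1 ≠ 0 := by
  intro h
  exact hα 0 (by simpa using eq_neg_of_add_eq_zero_left h)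

theorem mass_of_re {α β : ℂ} (hα : -1 < α.re) (hβ : -1 < β.re) :
    mass α β = Complex.Gamma (α + 1) * Complex.Gamma (β + 1) * (Complex.Gamma (α + β + 2))⁻¹ := by
  have h : mass α β = Complex.betaIntegral (α + 1) (β + 1) := by
    rw [mass, jacobiMeasure_eq_integral (by fun_prop) hα hβ, Complex.betaIntegral]
    simp
  have hg : Complex.Gamma (α + β + 2) ≠ 0 :=
    Complex.Gamma_ne_zero_of_re_pos (by simp; linarith)
  rw [h, Complex.Gamma_mul_Gamma_eq_betaIntegral (by simp; linarith) (by simp; linarith),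
    show α + 1 + (β + 1) = α + β + 2 by ring, mul_comm, inv_mul_cancel_left₀ hg]

/-- The total mass is the analytic continuation of the Beta integral. -/
theorem mass_eq {α β : ℂ}
    (hα : ∀ k : ℕ, α ≠ -((k : ℂ) + 1)) (hβ : ∀ k : ℕ, β ≠ -((k : ℂ) + 1)) :
    mass α β = Complex.Gamma (α + 1) * Complex.Gamma (β + 1) * (Complex.Gamma (α + β + 2))⁻¹ := by
  -- N counts the unit shifts that bring Re β above -1; once that holds, a second induction does the
  -- same for α.
  obtain ⟨N, hN⟩ := exists_nat_gt (-1 - β.re)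
  induction N generalizing β with
  | zero =>
    obtain ⟨N, hN'⟩ := exists_nat_gt (-1 - α.re)
    induction N generalizing α with
    | zero =>
      norm_num at hN hN'
      exact mass_of_re (by linarith) (by linarith)
    | succ N ih =>
      have h := ih (ne_neg_add_one hα) (by push_cast at hN'; simp; linarith)
      have h1 := mass_add_one_left hα hβ
      have h2 := add_one_ne_zero_of_ne hα
      -- 1/Γ(s) = s/Γ(s+1) holds for every s, since `Complex.Gamma` and its inverse are 0 at the
      -- poles. So no condition on α + β is needed here.
      have h3 := Complex.one_div_Gamma_eq_self_mul_one_div_Gamma_add_one (α + β + 2)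
      rw [h, Complex.Gamma_add_one _ h2] at h1
      refine mul_left_cancel₀ h2 (h1.trans ?_)
      rw [h3]
      ring_nf
  | succ N ih =>
    have h := ih (ne_neg_add_one hβ) (by push_cast at hN; simp; linarith)
    have h1 := mass_add_one_right hα hβ
    have h2 := add_one_ne_zero_of_ne hβ
    have h3 := Complex.one_div_Gamma_eq_self_mul_one_div_Gamma_add_one (α + β + 2)
    rw [h, Complex.Gamma_add_one _ h2] at h1
    refine mul_left_cancel₀ h2 (h1.trans ?_)
    rw [h3]
    ring_nf

/-- The condition on α + β + 1 keeps α + β + 2 off the poles of Γ, at which the mass would vanish.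
-/
theorem mass_ne_zero {α β : ℂ}
    (hα : ∀ k : ℕ, α ≠ -((k : ℂ) + 1)) (hβ : ∀ k : ℕ, β ≠ -((k : ℂ) + 1))
    (hαβ : ∀ k : ℕ, α + β + 1 ≠ -((k : ℂ) + 1)) : mass α β ≠ 0 := by
  rw [mass_eq hα hβ]
  refine mul_ne_zero (mul_ne_zero ?_ ?_) (inv_ne_zero ?_) <;>
    refine Complex.Gamma_ne_zero fun m hm => ?_
  · exact hα m (by linear_combination hm)
  · exact hβ m (by linear_combination hm)
  · exact hαβ m (by linear_combination hm)

/-! ### Moments and meromorphy in the parameters -/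

theorem jacobiMeasure_pow_mul_one_sub_pow {α β : ℂ}
    (hα : ∀ k : ℕ, α ≠ -((k : ℂ) + 1)) (hβ : ∀ k : ℕ, β ≠ -((k : ℂ) + 1)) (j k : ℕ) :
    jacobiMeasure α β (fun t => t ^ j * (1 - t) ^ k) = mass (α + j) (β + k) := by
  induction j generalizing α with
  | zero =>
    induction k generalizing β with
    | zero => simp [mass]
    | succ k ih =>
      have := jacobiMeasure_mul_one_sub (h := fun t => t ^ 0 * (1 - t) ^ k) (by fun_prop) hα hβ
      rw [ih (ne_neg_add_one hβ)] at this
      rw [show β + ((k + 1 : ℕ) : ℂ) = β + 1 + k by push_cast; ring, ← this]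
      congr 1 with t
      ring
  | succ j ih =>
    have := jacobiMeasure_mul_id (h := fun t => t ^ j * (1 - t) ^ k) (by fun_prop) hα hβ
    rw [ih (ne_neg_add_one hα)] at this
    rw [show α + ((j + 1 : ℕ) : ℂ) = α + 1 + j by push_cast; ring, ← this]
    congr 1 with t
    ring

theorem jacobiMeasure_eval {α β : ℂ}
    (hα : ∀ k : ℕ, α ≠ -((k : ℂ) + 1)) (hβ : ∀ k : ℕ, β ≠ -((k : ℂ) + 1)) (h : ℂ[X]) :
    jacobiMeasure α β (fun t => h.eval t) =
      ∑ k ∈ Finset.range (h.natDegree + 1), h.coeff k * mass (α + k) β := by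
  simp only [eval_eq_sum_range]
  rw [jacobiMeasure_sum _ _ (fun i => by fun_prop) hα hβ]
  refine Finset.sum_congr rfl fun k _ => ?_
  have := jacobiMeasure_pow_mul_one_sub_pow hα hβ k 0
  simp only [pow_zero, mul_one, Nat.cast_zero, add_zero] at this
  rw [this]

/-- Meromorphy at a point only depends on a punctured neighbourhood. The Gamma formula is valid
there even when the point itself is an excluded integer, so the value of `limUnder` at that point is
irrelevant. -/
theorem eventually_ne_neg_nat (z₀ : ℂ) : ∀ᶠ z in 𝓝[≠] z₀, ∀ k : ℕ, z ≠ -((k : ℂ) + 1) := by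
  have hc : IsClosed ((fun n : ℤ => ((n : ℝ) : ℂ)) '' {n : ℤ | ((n : ℝ) : ℂ) ≠ z₀}) :=
    (Complex.isometry_ofReal.isClosedEmbedding.comp Int.isClosedEmbedding_coe_real).isClosedMap _
      (isClosed_discrete _)
  have hm : ∀ᶠ z in 𝓝 z₀, z ∉ (fun n : ℤ => ((n : ℝ) : ℂ)) '' {n : ℤ | ((n : ℝ) : ℂ) ≠ z₀} :=
    hc.isOpen_compl.mem_nhds (by rintro ⟨n, hn, rfl⟩; exact hn rfl)
  filter_upwards [hm.filter_mono nhdsWithin_le_nhds, self_mem_nhdsWithin] with z h1 h2 k hk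
  have e : (((-(k + 1) : ℤ) : ℝ) : ℂ) = z := by rw [hk]; push_cast; ring
  exact h1 ⟨-(k + 1), by rw [Set.mem_ofPred_eq, e]; exact h2, e⟩

theorem meromorphicAt_Gamma_add (c z₀ : ℂ) :
    MeromorphicAt (fun z => Complex.Gamma (z + c)) z₀ :=
  (Meromorphic.Gamma (z₀ + c)).comp_analyticAt (g := fun z => z + c) (by fun_prop)

theorem meromorphicAt_jacobiMeasure_left {β : ℂ} (hβ : ∀ k : ℕ, β ≠ -((k : ℂ) + 1)) (h : ℂ[X])
    (z₀ : ℂ) : MeromorphicAt (fun z => jacobiMeasure z β fun t => h.eval t) z₀ := by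
  have hm : MeromorphicAt (fun z => ∑ k ∈ Finset.range (h.natDegree + 1), h.coeff k *
      (Complex.Gamma (z + (k + 1)) * Complex.Gamma (β + 1) *
        (Complex.Gamma (z + (k + β + 2)))⁻¹)) z₀ :=
    MeromorphicAt.fun_sum fun k _ => (MeromorphicAt.const _ _).mul
      (((meromorphicAt_Gamma_add _ _).mul (MeromorphicAt.const _ _)).mul
        (meromorphicAt_Gamma_add _ _).inv)
  refine hm.congr ?_
  filter_upwards [eventually_ne_neg_nat z₀] with z hz
  rw [jacobiMeasure_eval hz hβ]
  refine Finset.sum_congr rfl fun k _ => ?_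
  rw [mass_eq (ne_neg_add_nat hz k) hβ]
  ring_nf

theorem meromorphicAt_jacobiMeasure_right {α : ℂ} (hα : ∀ k : ℕ, α ≠ -((k : ℂ) + 1)) (h : ℂ[X])
    (w₀ : ℂ) : MeromorphicAt (fun w => jacobiMeasure α w fun t => h.eval t) w₀ := by
  have hm : MeromorphicAt (fun w => ∑ k ∈ Finset.range (h.natDegree + 1), h.coeff k *
      (Complex.Gamma (α + k + 1) * Complex.Gamma (w + 1) *
        (Complex.Gamma (w + (α + k + 2)))⁻¹)) w₀ :=
    MeromorphicAt.fun_sum fun k _ => (MeromorphicAt.const _ _).mul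
      (((MeromorphicAt.const _ _).mul (meromorphicAt_Gamma_add _ _)).mul
        (meromorphicAt_Gamma_add _ _).inv)
  refine hm.congr ?_
  filter_upwards [eventually_ne_neg_nat w₀] with w hw
  rw [jacobiMeasure_eval hα hw]
  refine Finset.sum_congr rfl fun k _ => ?_
  rw [mass_eq (ne_neg_add_nat hα k) hw]
  ring_nf

/-! ### Pochhammer symbols and Chu–Vandermonde -/

theorem poch_zero (a : ℂ) : poch a 0 = 1 := by simp [poch]

theorem poch_succ (a : ℂ) (k : ℕ) : poch a (k + 1) = poch a k * (a + k) :=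
  ascPochhammer_succ_eval k a

theorem poch_succ_left (a : ℂ) (k : ℕ) : poch a (k + 1) = a * poch (a + 1) k := by
  simp [poch, ascPochhammer_succ_left, eval_comp]

theorem poch_add (a : ℂ) (j k : ℕ) : poch a (j + k) = poch a j * poch (a + j) k := by
  induction k with
  | zero => simp [poch_zero]
  | succ k ih =>
    rw [← add_assoc, poch_succ, ih, poch_succ]
    push_cast
    ring

theorem poch_ne_zero {a : ℂ} (ha : ∀ k : ℕ, a ≠ -(k : ℂ)) (n : ℕ) : poch a n ≠ 0 := by
  intro h
  obtain ⟨k, -, hk⟩ := (ascPochhammer_eval_eq_zero_iff n a).1 h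
  exact ha k (by rw [hk, neg_neg])

theorem poch_neg_natCast {n j : ℕ} (hj : j ≤ n) :
    poch (-(n : ℂ)) j = (-1) ^ j * (n.choose j : ℂ) * (j.factorial : ℂ) := by
  induction j with
  | zero => simp [poch_zero]
  | succ j ih =>
    have h := congrArg (Nat.cast (R := ℂ)) (Nat.choose_succ_right_eq n j)
    push_cast [Nat.cast_sub (Nat.le_of_succ_le hj)] at h
    rw [poch_succ, ih (Nat.le_of_succ_le hj), Nat.factorial_succ]
    push_cast
    linear_combination (-1) ^ j * (j.factorial : ℂ) * h

/-- The Chu–Vandermonde identity. -/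
theorem chu_vandermonde (n : ℕ) (b c : ℂ) :
    ∑ ij ∈ Finset.HasAntidiagonal.antidiagonal n, (n.choose ij.1 : ℂ) *
      ((-1) ^ ij.1 * poch b ij.1 * poch (c + ij.1) ij.2) = poch (c - b) n := by
  induction n generalizing b c with
  | zero => simp [poch_zero]
  | succ n ih =>
    -- Pascal's rule splits the sum in two. In the first, the last factor c + i + j is the constant
    -- c + n; the second is -b times the identity for (b + 1, c + 1). Together they give the new
    -- factor c - b + n.
    rw [Finset.sum_antidiagonal_choose_succ_mul
      (fun i j => (-1 : ℂ) ^ i * poch b i * poch (c + i) j)]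
    have h1 : ∑ ij ∈ Finset.HasAntidiagonal.antidiagonal n, (n.choose ij.1 : ℂ) *
        ((-1) ^ ij.1 * poch b ij.1 * poch (c + ij.1) (ij.2 + 1)) =
        (c + n) * poch (c - b) n := by
      rw [← ih b c, Finset.mul_sum]
      refine Finset.sum_congr rfl fun ij hij => ?_
      rw [poch_succ, ← Finset.HasAntidiagonal.mem_antidiagonal.1 hij]
      push_cast
      ring
    have h2 : ∑ ij ∈ Finset.HasAntidiagonal.antidiagonal n, (n.choose ij.2 : ℂ) *
        ((-1) ^ (ij.1 + 1) * poch b (ij.1 + 1) * poch (c + ((ij.1 + 1 : ℕ) : ℂ)) ij.2) =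
        -b * poch (c - b) n := by
      rw [show c - b = (c + 1) - (b + 1) by ring, ← ih (b + 1) (c + 1), Finset.mul_sum]
      refine Finset.sum_congr rfl fun ij hij => ?_
      rw [poch_succ_left, ← Nat.choose_symm_of_eq_add (Finset.HasAntidiagonal.mem_antidiagonal.1 hij).symm]
      push_cast
      rw [show c + ((ij.1 : ℂ) + 1) = c + 1 + ij.1 by ring]
      ring
    rw [h1, h2, poch_succ]
    ring

/-! ### Integrals of the Jacobi polynomials -/

theorem mass_add_nat {α β : ℂ}
    (hα : ∀ k : ℕ, α ≠ -((k : ℂ) + 1)) (hβ : ∀ k : ℕ, β ≠ -((k : ℂ) + 1)) (j : ℕ) :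
    poch (α + β + 2) j * mass (α + j) β = poch (α + 1) j * mass α β := by
  induction j with
  | zero => simp [poch_zero]
  | succ j ih =>
    have h := mass_add_one_left (ne_neg_add_nat hα j) hβ
    rw [poch_succ, poch_succ, show α + ((j + 1 : ℕ) : ℂ) = α + j + 1 by push_cast; ring]
    linear_combination (α + 1 + j) * ih - poch (α + β + 2) j * h

/-- Termwise, the factor (α+1)_j from the Beta value cancels the denominator of the hypergeometric
coefficient. What remains is Chu–Vandermonde with b = α+β+n+1 and c = α+β+k+2, where c - b = k+1-n
no longer involves α and β. -/
theorem jacobiMeasure_jacobiPoly_mul_one_sub_pow {α β : ℂ}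
    (hα : ∀ k : ℕ, α ≠ -((k : ℂ) + 1)) (hβ : ∀ k : ℕ, β ≠ -((k : ℂ) + 1))
    (hαβ : ∀ k : ℕ, α + β + 1 ≠ -((k : ℂ) + 1)) (n k : ℕ) :
    jacobiMeasure α β (fun t => (jacobiPoly α β n).eval t * (1 - t) ^ k) =
      poch (α + 1) n / (n.factorial : ℂ) * (mass α (β + k) / poch (α + β + k + 2) n) *
        poch ((k : ℂ) + 1 - n) n := by
  have hc : ∀ j, poch (α + β + k + 2) j ≠ 0 :=
    poch_ne_zero fun m hm => ne_neg_add_nat hαβ k m (by linear_combination hm)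
  have ha : ∀ j, poch (α + 1) j ≠ 0 :=
    poch_ne_zero fun m hm => hα m (by linear_combination hm)
  have e : ∀ t : ℂ, (jacobiPoly α β n).eval t * (1 - t) ^ k =
      ∑ j ∈ Finset.range (n + 1), (poch (α + 1) n / (n.factorial : ℂ) *
        (poch (-(n : ℂ)) j * poch (α + β + n + 1) j / (poch (α + 1) j * (j.factorial : ℂ)))) *
        (t ^ j * (1 - t) ^ k) := by
    intro t
    simp only [jacobiPoly, eval_mul, eval_C, eval_finsetSum, eval_pow, eval_X, Finset.mul_sum,
      Finset.sum_mul]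
    refine Finset.sum_congr rfl fun j _ => ?_
    ring
  simp only [e]
  rw [jacobiMeasure_sum _ _ (fun j => by fun_prop) hα hβ,
    show (k : ℂ) + 1 - n = (α + β + k + 2) - (α + β + n + 1) by ring, ← chu_vandermonde,
    Finset.Nat.sum_antidiagonal_eq_sum_range_succ_mk, Finset.mul_sum]
  refine Finset.sum_congr rfl fun j hj => ?_
  have hjn : j ≤ n := Nat.lt_succ_iff.1 (Finset.mem_range.1 hj)
  have hm := mass_add_nat hα (ne_neg_add_nat hβ k) j
  rw [show α + (β + k) + 2 = α + β + k + 2 by ring] at hm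
  have hm' : mass (α + j) (β + k) = poch (α + 1) j * mass α (β + k) / poch (α + β + k + 2) j := by
    rw [eq_div_iff (hc j), ← hm, mul_comm]
  -- The common denominator (c)_n, divided by the (c)_j of the j-th term, leaves the factor
  -- (c+j)_{n-j} of Chu–Vandermonde.
  have hn : poch (α + β + k + 2) n =
      poch (α + β + k + 2) j * poch (α + β + k + 2 + j) (n - j) := by
    rw [← poch_add, Nat.add_sub_cancel' hjn]
  have hc2 : poch (α + β + k + 2 + j) (n - j) ≠ 0 := right_ne_zero_of_mul (hn ▸ hc n)
  have hf : (j.factorial : ℂ) ≠ 0 := by exact_mod_cast j.factorial_ne_zero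
  have hj1 := ha j
  have hj2 := hc j
  rw [jacobiMeasure_pow_mul_one_sub_pow hα hβ, hm', hn, poch_neg_natCast hjn]
  field_simp

/-- In the expansion of q in powers of 1 - t only the n-th power survives, because (k+1-n)_n
contains the factor 0 for every k < n. -/
theorem jacobiMeasure_jacobiPoly_mul {α β : ℂ}
    (hα : ∀ k : ℕ, α ≠ -((k : ℂ) + 1)) (hβ : ∀ k : ℕ, β ≠ -((k : ℂ) + 1))
    (hαβ : ∀ k : ℕ, α + β + 1 ≠ -((k : ℂ) + 1)) {n : ℕ} {q : ℂ[X]} (hq : q.natDegree ≤ n) :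
    jacobiMeasure α β (fun t => (jacobiPoly α β n).eval t * q.eval t) =
      (q.comp (1 - X)).coeff n *
        jacobiMeasure α β (fun t => (jacobiPoly α β n).eval t * (1 - t) ^ n) := by
  have hd : (q.comp (1 - X)).natDegree < n + 1 := by
    refine (natDegree_comp_le.trans ?_).trans_lt (Nat.lt_succ_of_le hq)
    have h1 : (1 - X : ℂ[X]).natDegree ≤ 1 := by compute_degree
    simpa using Nat.mul_le_mul_left q.natDegree h1
  have e : ∀ t : ℂ, (jacobiPoly α β n).eval t * q.eval t =
      ∑ k ∈ Finset.range (n + 1), (q.comp (1 - X)).coeff k *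
        ((jacobiPoly α β n).eval t * (1 - t) ^ k) := by
    intro t
    have : q.eval t = (q.comp (1 - X)).eval (1 - t) := by simp [eval_comp]
    rw [this, eval_eq_sum_range' hd, Finset.mul_sum]
    refine Finset.sum_congr rfl fun j _ => ?_
    ring
  simp only [e]
  rw [jacobiMeasure_sum _ _ (fun j => by fun_prop) hα hβ, Finset.sum_range_succ,
    Finset.sum_eq_zero, zero_add]
  intro k hk
  have hk := Finset.mem_range.1 hk
  have h0 : poch ((k : ℂ) + 1 - n) n = 0 := by
    refine (ascPochhammer_eval_eq_zero_iff n _).2 ⟨n - 1 - k, by omega, ?_⟩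
    rw [Nat.sub_sub, Nat.cast_sub (by omega)]
    push_cast
    ring
  rw [jacobiMeasure_jacobiPoly_mul_one_sub_pow hα hβ hαβ, h0, mul_zero, mul_zero]

/-- The leading term of q pairs nontrivially with P_d, d = deg q: at k = n = d the symbol (k+1-n)_n
is (1)_n, and the three parameter conditions keep the other factors nonzero. -/
theorem jacobiMeasure_jacobiPoly_mul_ne_zero {α β : ℂ}
    (hα : ∀ k : ℕ, α ≠ -((k : ℂ) + 1)) (hβ : ∀ k : ℕ, β ≠ -((k : ℂ) + 1))
    (hαβ : ∀ k : ℕ, α + β + 1 ≠ -((k : ℂ) + 1)) {q : ℂ[X]} (hq : q ≠ 0) :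
    jacobiMeasure α β (fun t => (jacobiPoly α β q.natDegree).eval t * q.eval t) ≠ 0 := by
  have h1 : (1 - X : ℂ[X]).natDegree = 1 := by
    rw [← neg_sub, natDegree_neg, ← C_1, natDegree_X_sub_C]
  have hd : (q.comp (1 - X)).natDegree = q.natDegree := by rw [natDegree_comp, h1, mul_one]
  have hl : (q.comp (1 - X)).coeff q.natDegree ≠ 0 := by
    rw [← hd, coeff_natDegree, leadingCoeff_comp (by rw [h1]; exact one_ne_zero)]
    refine mul_ne_zero (leadingCoeff_ne_zero.2 hq) (pow_ne_zero _ (leadingCoeff_ne_zero.2 ?_))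
    intro h0
    simp [h0] at h1
  rw [jacobiMeasure_jacobiPoly_mul hα hβ hαβ le_rfl,
    jacobiMeasure_jacobiPoly_mul_one_sub_pow hα hβ hαβ]
  generalize q.natDegree = n at hl ⊢
  have hn : (n.factorial : ℂ) ≠ 0 := by exact_mod_cast n.factorial_ne_zero
  refine mul_ne_zero hl (mul_ne_zero (mul_ne_zero (div_ne_zero ?_ hn) (div_ne_zero ?_ ?_)) ?_)
  · exact poch_ne_zero (fun m hm => hα m (by linear_combination hm)) n
  · exact mass_ne_zero hα (ne_neg_add_nat hβ n) fun m hm =>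
      ne_neg_add_nat hαβ n m (by linear_combination hm)
  · exact poch_ne_zero (fun m hm => ne_neg_add_nat hαβ n m (by linear_combination hm)) n
  · refine poch_ne_zero (fun m hm => ?_) n
    have : ((m + 1 : ℕ) : ℂ) = 0 := by push_cast; linear_combination hm
    exact absurd this (by exact_mod_cast m.succ_ne_zero)

theorem jacobiMeasure_jacobiPoly_mul_pow {α β : ℂ}
    (hα : ∀ k : ℕ, α ≠ -((k : ℂ) + 1)) (hβ : ∀ k : ℕ, β ≠ -((k : ℂ) + 1))
    (hαβ : ∀ k : ℕ, α + β + 1 ≠ -((k : ℂ) + 1)) {n k : ℕ} (hk : k < n) :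
    jacobiMeasure α β (fun t => (jacobiPoly α β n).eval t * t ^ k) = 0 := by
  have h := jacobiMeasure_jacobiPoly_mul hα hβ hαβ (q := X ^ k) (n := n)
    (by rw [natDegree_X_pow]; exact hk.le)
  simp only [eval_pow, eval_X] at h
  have h0 : ((X ^ k : ℂ[X]).comp (1 - X)).coeff n = 0 := by
    refine coeff_eq_zero_of_natDegree_lt (lt_of_le_of_lt ?_ hk)
    rw [X_pow_comp]
    have h1 : (1 - X : ℂ[X]).natDegree ≤ 1 := by compute_degree
    simpa using natDegree_pow_le_of_le k h1
  rw [h, h0, zero_mul]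

theorem natDegree_jacobiPoly_le (α β : ℂ) (n : ℕ) : (jacobiPoly α β n).natDegree ≤ n := by
  refine (natDegree_C_mul_le _ _).trans (natDegree_sum_le_of_forall_le _ _ fun k hk => ?_)
  exact (natDegree_C_mul_X_pow_le _ _).trans (Nat.lt_succ_iff.1 (Finset.mem_range.1 hk))

theorem coeff_jacobiPoly_ne_zero {α β : ℂ} (hα : ∀ k : ℕ, α ≠ -((k : ℂ) + 1))
    (hαβ : ∀ k : ℕ, α + β + 1 ≠ -((k : ℂ) + 1)) (n : ℕ) : (jacobiPoly α β n).coeff n ≠ 0 := by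
  have hn : (n.factorial : ℂ) ≠ 0 := by exact_mod_cast n.factorial_ne_zero
  have ha : poch (α + 1) n ≠ 0 := poch_ne_zero (fun m hm => hα m (by linear_combination hm)) n
  have hb : poch (α + β + n + 1) n ≠ 0 := by
    cases n with
    -- For n = 0 the product is empty; the general argument would fail there, as α + β + 1 = 0 is
    -- allowed.
    | zero => simp [poch_zero]
    | succ n =>
      refine poch_ne_zero (fun m hm => ne_neg_add_nat hαβ n m ?_) _
      push_cast at hm
      linear_combination hm
  have hc : poch (-(n : ℂ)) n ≠ 0 := by
    rw [poch_neg_natCast le_rfl, Nat.choose_self]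
    simpa using hn
  simp only [jacobiPoly, coeff_C_mul, finsetSum_coeff, coeff_X_pow, mul_ite, mul_one, mul_zero,
    Finset.sum_ite_eq, Finset.mem_range, Nat.lt_succ_self, if_true]
  exact mul_ne_zero (div_ne_zero ha hn) (div_ne_zero (mul_ne_zero hc hb) (mul_ne_zero ha hn))

/-! ### Orthogonality, uniqueness and perfectness -/

theorem isMultipleOrthogonal_iff {μ : (ℂ → ℂ) → ℂ} {n : ℕ} {p : ℂ[X]} :
    IsMultipleOrthogonal (fun _ : Fin 1 => μ) (fun _ => n) p ↔
      p ≠ 0 ∧ p.natDegree ≤ n ∧ ∀ k < n, μ (fun t => p.eval t * t ^ k) = 0 := by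
  simp [IsMultipleOrthogonal]

theorem isMultipleOrthogonal_jacobiPoly {α β : ℂ}
    (hα : ∀ k : ℕ, α ≠ -((k : ℂ) + 1)) (hβ : ∀ k : ℕ, β ≠ -((k : ℂ) + 1))
    (hαβ : ∀ k : ℕ, α + β + 1 ≠ -((k : ℂ) + 1)) (n : ℕ) :
    IsMultipleOrthogonal (fun _ : Fin 1 => jacobiMeasure α β) (fun _ => n)
      (jacobiPoly α β n) := by
  refine isMultipleOrthogonal_iff.2 ⟨?_, natDegree_jacobiPoly_le α β n,
    fun k hk => jacobiMeasure_jacobiPoly_mul_pow hα hβ hαβ hk⟩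
  intro h
  exact coeff_jacobiPoly_ne_zero hα hαβ n (by rw [h, coeff_zero])

/-- Subtracting the multiple of P_n with the same coefficient of X^n leaves q of some degree d < n,
unless it is 0. Being orthogonal to all powers below n, q is orthogonal to P_d, which contradicts ∫
P_d q ≠ 0. -/
theorem eq_C_mul_jacobiPoly {α β : ℂ}
    (hα : ∀ k : ℕ, α ≠ -((k : ℂ) + 1)) (hβ : ∀ k : ℕ, β ≠ -((k : ℂ) + 1))
    (hαβ : ∀ k : ℕ, α + β + 1 ≠ -((k : ℂ) + 1)) {n : ℕ} {p : ℂ[X]}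
    (hp : IsMultipleOrthogonal (fun _ : Fin 1 => jacobiMeasure α β) (fun _ => n) p) :
    ∃ c : ℂ, p = C c * jacobiPoly α β n := by
  obtain ⟨-, hd, ho⟩ := isMultipleOrthogonal_iff.1 hp
  have hc := coeff_jacobiPoly_ne_zero hα hαβ n
  set c := p.coeff n / (jacobiPoly α β n).coeff n with hcdef
  refine ⟨c, sub_eq_zero.1 ?_⟩
  set q := p - C c * jacobiPoly α β n with hq
  by_contra hq0
  have hqd : q.natDegree ≤ n :=
    (natDegree_sub_le _ _).trans (max_le hd ((natDegree_C_mul_le _ _).trans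
      (natDegree_jacobiPoly_le α β n)))
  have hqc : q.coeff n = 0 := by
    rw [hq, coeff_sub, coeff_C_mul, hcdef, div_mul_cancel₀ _ hc, sub_self]
  have hqn : q.natDegree < n := by
    refine lt_of_le_of_ne hqd fun h => hq0 (leadingCoeff_eq_zero.1 ?_)
    rw [leadingCoeff, h, hqc]
  have hqo : ∀ k < n, jacobiMeasure α β (fun t => q.eval t * t ^ k) = 0 := by
    intro k hk
    have h := jacobiMeasure_sum (Finset.univ : Finset (Fin 2)) ![1, -c]
      (f := ![fun t => p.eval t * t ^ k, fun t => (jacobiPoly α β n).eval t * t ^ k])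
      (by intro i; fin_cases i <;> simp <;> fun_prop) hα hβ
    simp only [Fin.sum_univ_two, Matrix.cons_val_zero, Matrix.cons_val_one] at h
    rw [ho k hk, jacobiMeasure_jacobiPoly_mul_pow hα hβ hαβ hk] at h
    rw [mul_zero, mul_zero, add_zero] at h
    rw [← h]
    congr 1 with t
    simp only [hq, eval_sub, eval_mul, eval_C]
    ring
  refine jacobiMeasure_jacobiPoly_mul_ne_zero hα hβ hαβ hq0 ?_
  have e : ∀ t : ℂ, (jacobiPoly α β q.natDegree).eval t * q.eval t =
      ∑ k ∈ Finset.range (q.natDegree + 1), (jacobiPoly α β q.natDegree).coeff k *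
        (q.eval t * t ^ k) := by
    intro t
    rw [eval_eq_sum_range' (Nat.lt_succ_of_le (natDegree_jacobiPoly_le α β q.natDegree)),
      Finset.sum_mul]
    refine Finset.sum_congr rfl fun j _ => ?_
    ring
  simp only [e]
  rw [jacobiMeasure_sum _ _ (fun j => by fun_prop) hα hβ]
  refine Finset.sum_eq_zero fun k hk => ?_
  rw [hqo k ((Nat.lt_succ_iff.1 (Finset.mem_range.1 hk)).trans_lt hqn), mul_zero]

theorem isPerfectSystem_jacobiMeasure {α β : ℂ}
    (hα : ∀ k : ℕ, α ≠ -((k : ℂ) + 1)) (hβ : ∀ k : ℕ, β ≠ -((k : ℂ) + 1))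
    (hαβ : ∀ k : ℕ, α + β + 1 ≠ -((k : ℂ) + 1)) :
    IsPerfectSystem (fun _ : Fin 1 => jacobiMeasure α β) := by
  intro n p hp
  obtain ⟨m, rfl⟩ : ∃ m : ℕ, n = fun _ => m := ⟨n 0, funext fun i => by rw [Subsingleton.elim i 0]⟩
  obtain ⟨c, hc⟩ := eq_C_mul_jacobiPoly hα hβ hαβ hp
  have hc0 : c ≠ 0 := by
    rintro rfl
    exact hp.1 (by rw [hc, C_0, zero_mul])
  rw [hc, natDegree_C_mul hc0, natDegree_eq_of_le_of_coeff_ne_zero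
    (natDegree_jacobiPoly_le α β m) (coeff_jacobiPoly_ne_zero hα hαβ m)]
  simp

end FormalJacobi

theorem mainTheorem2 (α β : ℂ)
    (hα : ∀ k : ℕ, α ≠ -((k : ℂ) + 1))
    (hβ : ∀ k : ℕ, β ≠ -((k : ℂ) + 1))
    (hαβ : ∀ k : ℕ, α + β + 1 ≠ -((k : ℂ) + 1)) :
    -- the limit defining the measure exists for every entire function
    (∀ h : ℂ → ℂ, Differentiable ℂ h →
      Tendsto (fun p : ℂ × ℂ => FormalJacobi.normalizedIntegral h p.1 p.2)
        (FormalJacobi.paramFilter α β) (𝓝 (FormalJacobi.jacobiMeasure α β h))) ∧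
    -- it is the meromorphic continuation, in both parameters, of the Jacobi weight on `[0, 1]`
    (∀ h : Polynomial ℂ,
      MeromorphicOn (fun z => FormalJacobi.jacobiMeasure z β fun t => h.eval t) Set.univ ∧
      MeromorphicOn (fun w => FormalJacobi.jacobiMeasure α w fun t => h.eval t) Set.univ ∧
      (-1 < α.re → -1 < β.re →
        FormalJacobi.jacobiMeasure α β (fun t => h.eval t) =
          ∫ x in (0 : ℝ)..1, h.eval (x : ℂ) * ((x : ℂ) ^ α * (1 - (x : ℂ)) ^ β))) ∧
    -- the single measure is a perfect system
    FormalJacobi.IsPerfectSystem (fun _ : Fin 1 => FormalJacobi.jacobiMeasure α β) ∧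
    -- the Jacobi polynomial is its `n`-th formal orthogonal polynomial, unique up to a scalar
    ∀ n : ℕ,
      FormalJacobi.IsMultipleOrthogonal (fun _ : Fin 1 => FormalJacobi.jacobiMeasure α β)
        (fun _ => n) (FormalJacobi.jacobiPoly α β n) ∧
      ∀ p : Polynomial ℂ,
        FormalJacobi.IsMultipleOrthogonal (fun _ : Fin 1 => FormalJacobi.jacobiMeasure α β)
          (fun _ => n) p →
        ∃ c : ℂ, p = Polynomial.C c * FormalJacobi.jacobiPoly α β n := by
  refine ⟨fun h hh => FormalJacobi.tendsto_jacobiMeasure hh hα hβ, fun h => ⟨fun z _ => ?_,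
    fun w _ => ?_, fun h1 h2 => FormalJacobi.jacobiMeasure_eq_integral h.differentiable h1 h2⟩,
    FormalJacobi.isPerfectSystem_jacobiMeasure hα hβ hαβ, fun n =>
    ⟨FormalJacobi.isMultipleOrthogonal_jacobiPoly hα hβ hαβ n,
      fun p hp => FormalJacobi.eq_C_mul_jacobiPoly hα hβ hαβ hp⟩⟩
  · exact FormalJacobi.meromorphicAt_jacobiMeasure_left hβ h z
  · exact FormalJacobi.meromorphicAt_jacobiMeasure_right hα h w
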